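/- A \emph{$2$-copula} is a function $C:[0,1]^2\to\mathbb{R}$ with $C(u,0)=C(0,v)=0$, $C(u,1)=u$, $C(1,v)=v$ for all $u,v\in[0,1]$, and $C(u_2,v_2)-C(u_2,v_1)-C(u_1,v_2)+C(u_1,v_1)\ge 0$ whenever $0\le u_1\le u_2\le 1$ and $0\le v_1\le v_2\le 1$. For every fixed value of the other variable, the partial derivatives $\partial_1 C$ and $\partial_2 C$ exist almost everywhere on $[0,1]$ in the variable of differentiation. The \emph{Markov product} of two $2$-copulas $C_1, C_2$ is $$(C_1*C_2)(u,v)=\int_0^1 \partial_2 C_1(u,t)\,\partial_1 C_2(t,v)\,dt,\qquad u,v\in[0,1].$$ A $2$-copula $C$ is \emph{stochastically increasing} (resp. \emph{stochastically decreasing}) \emph{in the first component} if for every $v\in[0,1]$ there is a Lebesgue null set $N$ such that $u\mapsto\partial_1 C(u,v)$ exists and is decreasing (resp. increasing), in the weak sense, on $[0,1]\setminus N$. \textbf{Theorem.} Let $C$ be a $2$-copula. Then $C$ is stochastically increasing in the first component if and only if $$(D*C)(u,v)\le C(u,v)\quad\text{for all $2$-copulas } D \text{ and all } u,v\in[0,1].$$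 Likewise, $C$ is stochastically decreasing in the first component if and only if $$C(u,v)\le (D*C)(u,v)\quad\text{for all $2$-copulas } D \text{ and all } u,v\in[0,1].$$ -/

import Mathlib

open Set MeasureTheory

/-- A `2`-copula: a bivariate distribution function on `[0,1]²` with uniform margins, i.e. a
grounded, `2`-increasing function on `[0,1]²` with `C(u,1) = u` and `C(1,v) = v`.
The function is total on `ℝ × ℝ`; only its values on `[0,1]²` are constrained, and only those
values matter below. -/
structure Copula where
  toFun : ℝ → ℝ → ℝ
  zero_left : ∀ v ∈ Icc (0 : ℝ) 1, toFun 0 v = 0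
  zero_right : ∀ u ∈ Icc (0 : ℝ) 1, toFun u 0 = 0
  one_left : ∀ v ∈ Icc (0 : ℝ) 1, toFun 1 v = v
  one_right : ∀ u ∈ Icc (0 : ℝ) 1, toFun u 1 = u
  two_increasing : ∀ u₁ ∈ Icc (0 : ℝ) 1, ∀ u₂ ∈ Icc (0 : ℝ) 1,
    ∀ v₁ ∈ Icc (0 : ℝ) 1, ∀ v₂ ∈ Icc (0 : ℝ) 1, u₁ ≤ u₂ → v₁ ≤ v₂ →
      0 ≤ toFun u₂ v₂ - toFun u₂ v₁ - toFun u₁ v₂ + toFun u₁ v₁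

namespace Copula

instance : CoeFun Copula (fun _ => ℝ → ℝ → ℝ) := ⟨Copula.toFun⟩

/-- The partial derivative `∂₁C(u,v)` (it exists for almost every `u ∈ [0,1]`; the default value
of `deriv` is used only on the exceptional null set). -/
noncomputable def partial₁ (C : Copula) (u v : ℝ) : ℝ := deriv (fun s : ℝ => C s v) u

/-- The partial derivative `∂₂C(u,v)`. -/
noncomputable def partial₂ (C : Copula) (u v : ℝ) : ℝ := deriv (fun t : ℝ => C u t) v

/-- The Markov product `(C₁ * C₂)(u,v) = ∫₀¹ ∂₂C₁(u,t) ∂₁C₂(t,v) dt`. -/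
noncomputable def markovProduct (C₁ C₂ : Copula) (u v : ℝ) : ℝ :=
  ∫ t in (0 : ℝ)..1, C₁.partial₂ u t * C₂.partial₁ t v

/-- `C` is stochastically increasing in the first component: for every `v ∈ [0,1]`, the partial
derivative `u ↦ ∂₁C(u,v)` exists and is decreasing on `[0,1]` outside a null set. -/
def StochIncreasing₁ (C : Copula) : Prop :=
  ∀ v ∈ Icc (0 : ℝ) 1, ∃ N : Set ℝ, volume N = 0 ∧
    (∀ u ∈ Icc (0 : ℝ) 1 \ N, DifferentiableAt ℝ (fun s : ℝ => C s v) u) ∧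
    AntitoneOn (fun u : ℝ => C.partial₁ u v) (Icc (0 : ℝ) 1 \ N)

/-- `C` is stochastically decreasing in the first component: for every `v ∈ [0,1]`, the partial
derivative `u ↦ ∂₁C(u,v)` exists and is increasing on `[0,1]` outside a null set. -/
def StochDecreasing₁ (C : Copula) : Prop :=
  ∀ v ∈ Icc (0 : ℝ) 1, ∃ N : Set ℝ, volume N = 0 ∧
    (∀ u ∈ Icc (0 : ℝ) 1 \ N, DifferentiableAt ℝ (fun s : ℝ => C s v) u) ∧
    MonotoneOn (fun u : ℝ => C.partial₁ u v) (Icc (0 : ℝ) 1 \ N)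

end Copula

/-! Both properties are about the shape of the sections `C(·,v)`: decreasing derivative means
concave, increasing means convex. For any `D`, the weight `∂₂D(u,·)` lies in `[0,1]` and has mass
`u`. Against a decreasing `∂₁C(·,v)` the best such weight is the indicator of `[0,u]`, which gives
`C(u,v)` (`integral_mul_le_integral_of_antitoneOn`). Conversely, `productPatch x y` at `u = ax + by`
has weight `1`, `b`, `0` on `(0,x)`, `(x,y)`, `(y,1)`, so its product with `C` is `aC(x,v) +
bC(y,v)` (`markovProduct_productPatch`), and the assumed inequality is concavity or convexity
itself. -/

namespace Copula

/-- The transposed copula `(u, v) ↦ C(v, u)`. -/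
def swap (C : Copula) : Copula where
  toFun u v := C v u
  zero_left := C.zero_right
  zero_right := C.zero_left
  one_left := C.one_right
  one_right := C.one_left
  two_increasing u₁ hu₁ u₂ hu₂ v₁ hv₁ v₂ hv₂ hu hv := by
    have := C.two_increasing v₁ hv₁ v₂ hv₂ u₁ hu₁ u₂ hu₂ hv hu
    linarith

theorem monotoneOn_left (C : Copula) {v : ℝ} (hv : v ∈ Icc (0 : ℝ) 1) :
    MonotoneOn (fun s => C s v) (Icc 0 1) := by
  intro a ha b hb hab
  have h := C.two_increasing a ha b hb 0 (by simp) v hv hab hv.1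
  rw [C.zero_right a ha, C.zero_right b hb] at h
  simp only
  linarith

theorem lipschitzOnWith_left (C : Copula) {v : ℝ} (hv : v ∈ Icc (0 : ℝ) 1) :
    LipschitzOnWith 1 (fun s => C s v) (Icc 0 1) := by
  refine LipschitzOnWith.of_le_add_mul 1 fun a ha b hb => ?_
  rcases le_total a b with hab | hab
  · have := C.monotoneOn_left hv ha hb hab
    have := dist_nonneg (x := a) (y := b)
    simp only [NNReal.coe_one] at *
    linarith
  -- The mass of `[b,a] × [v,1]` is nonnegative, so the section at `v` grows no faster than the
  -- margin at `1`.
  · have h := C.two_increasing b hb a ha v hv 1 (by simp) hab hv.2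
    rw [C.one_right a ha, C.one_right b hb] at h
    rw [Real.dist_eq, abs_of_nonneg (by linarith), NNReal.coe_one]
    linarith

theorem monotoneOn_right (C : Copula) {u : ℝ} (hu : u ∈ Icc (0 : ℝ) 1) :
    MonotoneOn (fun t => C u t) (Icc 0 1) :=
  C.swap.monotoneOn_left hu

theorem lipschitzOnWith_right (C : Copula) {u : ℝ} (hu : u ∈ Icc (0 : ℝ) 1) :
    LipschitzOnWith 1 (fun t => C u t) (Icc 0 1) :=
  C.swap.lipschitzOnWith_left hu

end Copula

/-! ### Derivatives of Lipschitz sections -/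

theorem deriv_mem_Icc_of_monotoneOn_of_lipschitzOnWith {f : ℝ → ℝ} (hm : MonotoneOn f (Icc 0 1))
    (hl : LipschitzOnWith 1 f (Icc 0 1)) {t : ℝ} (ht : t ∈ Ioo (0 : ℝ) 1) :
    deriv f t ∈ Icc (0 : ℝ) 1 := by
  have hn : Icc (0 : ℝ) 1 ∈ nhds t := Icc_mem_nhds ht.1 ht.2
  constructor
  · rw [← derivWithin_of_mem_nhds hn]
    exact hm.derivWithin_nonneg
  · have := norm_deriv_le_of_lipschitzOn hn hl
    exact (le_abs_self _).trans (by simpa using this)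

theorem LipschitzOnWith.intervalIntegrable_deriv_and_integral_deriv {f : ℝ → ℝ} {K : NNReal}
    (hl : LipschitzOnWith K f (Icc 0 1)) {a b : ℝ}
    (ha : a ∈ Icc (0 : ℝ) 1) (hb : b ∈ Icc (0 : ℝ) 1) :
    IntervalIntegrable (deriv f) volume a b ∧ ∫ t in a..b, deriv f t = f b - f a := by
  have hac : AbsolutelyContinuousOnInterval f a b :=
    (hl.mono (uIcc_subset_Icc ha hb)).absolutelyContinuousOnInterval
  exact ⟨hac.intervalIntegrable_deriv, hac.integral_deriv_eq_sub⟩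

/-- The endpoints go into `N`: values outside `[0,1]` are arbitrary, so two-sided differentiability
may fail there. -/
theorem LipschitzOnWith.exists_null_differentiableAt {f : ℝ → ℝ} {K : NNReal}
    (hl : LipschitzOnWith K f (Icc 0 1)) :
    ∃ N : Set ℝ, volume N = 0 ∧
      ∀ u ∈ Icc (0 : ℝ) 1 \ N, u ∈ Ioo (0 : ℝ) 1 ∧ DifferentiableAt ℝ f u := by
  have h : ∀ᵐ u : ℝ, u ∈ Icc (0 : ℝ) 1 → u ∈ Ioo (0 : ℝ) 1 ∧ DifferentiableAt ℝ f u := by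
    filter_upwards [hl.ae_differentiableWithinAt_of_mem_real, volume.ae_ne (0 : ℝ),
      volume.ae_ne (1 : ℝ)]
      with u hu h0 h1 hu'
    have hI : u ∈ Ioo (0 : ℝ) 1 := ⟨hu'.1.lt_of_ne h0.symm, hu'.2.lt_of_ne h1⟩
    exact ⟨hI, (hu hu').differentiableAt (Icc_mem_nhds hI.1 hI.2)⟩
  refine ⟨_, ae_iff.1 h, fun u hu => ?_⟩
  by_contra hc
  exact hu.2 fun h' => hc (h' hu.1)

theorem intervalIntegrable_of_measurable_of_mem_Icc {g : ℝ → ℝ} (hg : Measurable g)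
    (hg' : ∀ t ∈ Ioo (0 : ℝ) 1, g t ∈ Icc (0 : ℝ) 1) {a b : ℝ}
    (ha : a ∈ Icc (0 : ℝ) 1) (hb : b ∈ Icc (0 : ℝ) 1) : IntervalIntegrable g volume a b := by
  have h01 : IntervalIntegrable g volume 0 1 := by
    rw [intervalIntegrable_iff_integrableOn_Ioo_of_le zero_le_one]
    refine Measure.integrableOn_of_bounded (M := 1) (by simp) hg.aestronglyMeasurable ?_
    filter_upwards [ae_restrict_mem measurableSet_Ioo] with t ht
    rw [Real.norm_eq_abs, abs_le]
    exact ⟨by linarith [(hg' t ht).1], (hg' t ht).2⟩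
  exact h01.mono_set (by rw [uIcc_of_le (zero_le_one' ℝ)]; exact uIcc_subset_Icc ha hb)

/-- A bathtub principle: among weights with values in `[0,1]` and total mass `u`, the indicator
of `[0,u]` maximises the integral against a decreasing function. -/
theorem integral_mul_le_integral_of_antitoneOn {g h : ℝ → ℝ} (hg : Measurable g)
    (hh : Measurable h) (hg' : ∀ t ∈ Ioo (0 : ℝ) 1, g t ∈ Icc (0 : ℝ) 1)
    (hh' : ∀ t ∈ Ioo (0 : ℝ) 1, h t ∈ Icc (0 : ℝ) 1) {u : ℝ} (hu : u ∈ Icc (0 : ℝ) 1)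
    (hint : ∫ t in (0 : ℝ)..1, h t = u) {N : Set ℝ} (hN : volume N = 0)
    (hanti : AntitoneOn g (Icc 0 1 \ N)) :
    ∫ t in (0 : ℝ)..1, h t * g t ≤ ∫ t in (0 : ℝ)..u, g t := by
  have h0 : (0 : ℝ) ∈ Icc (0 : ℝ) 1 := by simp
  have h1 : (1 : ℝ) ∈ Icc (0 : ℝ) 1 := by simp
  -- The threshold `c` is the supremum of `g` beyond `u`; inserting `0`, a lower bound of `g`, keeps
  -- the set nonempty when `u = 1`.
  obtain ⟨c, hcl, hcr⟩ : ∃ c, (∀ t ∈ Ioo 0 u \ N, c ≤ g t) ∧ ∀ t ∈ Ioo u 1 \ N, g t ≤ c := by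
    have hbdd : BddAbove (insert 0 (g '' (Ioo u 1 \ N))) := by
      refine ⟨1, ?_⟩
      rintro _ (rfl | ⟨t, ht, rfl⟩)
      · exact zero_le_one
      · exact (hg' t ⟨hu.1.trans_lt ht.1.1, ht.1.2⟩).2
    refine ⟨sSup (insert 0 (g '' (Ioo u 1 \ N))), fun t ht => ?_, fun t ht => ?_⟩
    · refine csSup_le (insert_nonempty _ _) ?_
      rintro _ (rfl | ⟨s, hs, rfl⟩)
      · exact (hg' t ⟨ht.1.1, ht.1.2.trans_le hu.2⟩).1
      · exact hanti ⟨⟨ht.1.1.le, ht.1.2.le.trans hu.2⟩, ht.2⟩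
          ⟨⟨hu.1.trans hs.1.1.le, hs.1.2.le⟩, hs.2⟩ (ht.1.2.trans hs.1.1).le
    · exact le_csSup hbdd (mem_insert_of_mem _ ⟨t, ht, rfl⟩)
  have ig := fun {a b : ℝ} (ha : a ∈ Icc (0 : ℝ) 1) (hb : b ∈ Icc (0 : ℝ) 1) =>
    intervalIntegrable_of_measurable_of_mem_Icc hg hg' ha hb
  have ih := fun {a b : ℝ} (ha : a ∈ Icc (0 : ℝ) 1) (hb : b ∈ Icc (0 : ℝ) 1) =>
    intervalIntegrable_of_measurable_of_mem_Icc hh hh' ha hb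
  have ihg := fun {a b : ℝ} (ha : a ∈ Icc (0 : ℝ) 1) (hb : b ∈ Icc (0 : ℝ) 1) =>
    intervalIntegrable_of_measurable_of_mem_Icc (hh.mul hg)
      (fun t ht => unitInterval.mul_mem (hh' t ht) (hg' t ht)) ha hb
  have hNae : ∀ᵐ t : ℝ, t ∉ N := measure_eq_zero_iff_ae_notMem.1 hN
  -- This is `(g - c)(1 - h) ≥ 0` before `u`; `hr` is `(g - c)h ≤ 0` after it. In the sum `c`
  -- cancels, as `h` has mass `u`.
  have hl : ∫ t in (0 : ℝ)..u, h t * g t ≤ ∫ t in (0 : ℝ)..u, (g t - c + c * h t) := by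
    refine intervalIntegral.integral_mono_ae_restrict hu.1 (ihg h0 hu)
      (((ig h0 hu).sub intervalIntegrable_const).add ((ih h0 hu).const_mul c)) ?_
    filter_upwards [ae_restrict_mem measurableSet_Icc, ae_restrict_of_ae hNae,
      ae_restrict_of_ae (volume.ae_ne (0 : ℝ)), ae_restrict_of_ae (volume.ae_ne u)]
      with t ht htN ht0 htu
    have htI : t ∈ Ioo 0 u := ⟨ht.1.lt_of_ne ht0.symm, ht.2.lt_of_ne htu⟩
    have := hcl t ⟨htI, htN⟩
    have := (hh' t ⟨htI.1, htI.2.trans_le hu.2⟩).2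
    nlinarith
  have hr : ∫ t in u..1, h t * g t ≤ ∫ t in u..1, c * h t := by
    refine intervalIntegral.integral_mono_ae_restrict hu.2 (ihg hu h1) ((ih hu h1).const_mul c) ?_
    filter_upwards [ae_restrict_mem measurableSet_Icc, ae_restrict_of_ae hNae,
      ae_restrict_of_ae (volume.ae_ne (1 : ℝ)), ae_restrict_of_ae (volume.ae_ne u)]
      with t ht htN ht1 htu
    have htI : t ∈ Ioo u 1 := ⟨ht.1.lt_of_ne htu.symm, ht.2.lt_of_ne ht1⟩
    have := hcr t ⟨htI, htN⟩
    have := (hh' t ⟨hu.1.trans_lt htI.1, htI.2⟩).1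
    nlinarith
  rw [intervalIntegral.integral_add ((ig h0 hu).sub intervalIntegrable_const)
    ((ih h0 hu).const_mul c), intervalIntegral.integral_sub (ig h0 hu) intervalIntegrable_const,
    intervalIntegral.integral_const, intervalIntegral.integral_const_mul, smul_eq_mul] at hl
  rw [intervalIntegral.integral_const_mul] at hr
  have hsum := intervalIntegral.integral_add_adjacent_intervals (ihg h0 hu) (ihg hu h1)
  have hsum' := intervalIntegral.integral_add_adjacent_intervals (ih h0 hu) (ih hu h1)
  rw [hint] at hsum'
  simp only [Pi.mul_apply] at hsum
  have : c * (∫ t in (0 : ℝ)..u, h t) + c * (∫ t in u..1, h t) = c * u := by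
    rw [← mul_add, hsum']
  linarith

/-- The antitone case applied to `1 - g`. -/
theorem integral_le_integral_mul_of_monotoneOn {g h : ℝ → ℝ} (hg : Measurable g)
    (hh : Measurable h) (hg' : ∀ t ∈ Ioo (0 : ℝ) 1, g t ∈ Icc (0 : ℝ) 1)
    (hh' : ∀ t ∈ Ioo (0 : ℝ) 1, h t ∈ Icc (0 : ℝ) 1) {u : ℝ} (hu : u ∈ Icc (0 : ℝ) 1)
    (hint : ∫ t in (0 : ℝ)..1, h t = u) {N : Set ℝ} (hN : volume N = 0)
    (hmono : MonotoneOn g (Icc 0 1 \ N)) :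
    ∫ t in (0 : ℝ)..u, g t ≤ ∫ t in (0 : ℝ)..1, h t * g t := by
  have h0 : (0 : ℝ) ∈ Icc (0 : ℝ) 1 := by simp
  have h1 : (1 : ℝ) ∈ Icc (0 : ℝ) 1 := by simp
  have key := integral_mul_le_integral_of_antitoneOn (g := fun t => 1 - g t)
    (measurable_const.sub hg) hh (fun t ht => by simpa [and_comm] using hg' t ht) hh'
    hu hint hN fun a ha b hb hab => sub_le_sub_left (hmono ha hb hab) 1
  simp only [mul_sub, mul_one] at key
  have ihg : IntervalIntegrable (fun t => h t * g t) volume 0 1 :=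
    intervalIntegrable_of_measurable_of_mem_Icc (hh.mul hg)
      (fun t ht => unitInterval.mul_mem (hh' t ht) (hg' t ht)) h0 h1
  rw [intervalIntegral.integral_sub (intervalIntegrable_of_measurable_of_mem_Icc hh hh' h0 h1) ihg,
    intervalIntegral.integral_sub intervalIntegrable_const
      (intervalIntegrable_of_measurable_of_mem_Icc hg hg' h0 hu), hint] at key
  rw [intervalIntegral.integral_const, smul_eq_mul, sub_zero, mul_one] at key
  linarith

/-! ### Test copulas and the characterisation -/

namespace Copula

/-- The ordinal sum of the minimum copula with the product copula placed on the square
`[x,y]²`. -/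
noncomputable def productPatch (x y : ℝ) (hx : 0 ≤ x) (hxy : x < y) (hy : y ≤ 1) : Copula where
  toFun s t := min x (min s t)
    + max 0 (min (s - x) (y - x)) * max 0 (min (t - x) (y - x)) / (y - x) + max 0 (min s t - y)
  zero_left v hv := by
    rw [min_eq_left hv.1, min_eq_right hx, min_eq_left (by linarith : 0 - x ≤ y - x),
      max_eq_left (by linarith : 0 - x ≤ 0), max_eq_left (by linarith : 0 - y ≤ 0)]
    simp
  zero_right u hu := by
    rw [min_eq_right hu.1, min_eq_right hx, min_eq_left (by linarith : 0 - x ≤ y - x),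
      max_eq_left (by linarith : 0 - x ≤ 0), max_eq_left (by linarith : 0 - y ≤ 0)]
    simp
  one_left v hv := by
    have h : y - x ≠ 0 := by linarith
    rw [min_eq_right hv.2, min_eq_right (by linarith : y - x ≤ 1 - x),
      max_eq_right (by linarith : 0 ≤ y - x), mul_div_cancel_left₀ _ h]
    grind
  one_right u hu := by
    have h : y - x ≠ 0 := by linarith
    rw [min_eq_left hu.2, min_eq_right (by linarith : y - x ≤ 1 - x),
      max_eq_right (by linarith : 0 ≤ y - x), mul_div_cancel_right₀ _ h]
    grind
  two_increasing u₁ _ u₂ _ v₁ _ v₂ _ hu hv := by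
    -- Each of the three summands is separately 2-increasing; the middle one is a product of
    -- increasing functions.
    have h₁ : 0 ≤ min x (min u₂ v₂) - min x (min u₂ v₁) - min x (min u₁ v₂) + min x (min u₁ v₁) := by
      grind
    have h₂ : 0 ≤ max 0 (min u₂ v₂ - y) - max 0 (min u₂ v₁ - y) - max 0 (min u₁ v₂ - y)
        + max 0 (min u₁ v₁ - y) := by
      grind
    have hq : ∀ a b : ℝ, a ≤ b → max 0 (min (a - x) (y - x)) ≤ max 0 (min (b - x) (y - x)) :=
      fun a b hab => by gcongr
    have h₃ := div_nonneg (mul_nonneg (sub_nonneg.2 (hq _ _ hu)) (sub_nonneg.2 (hq _ _ hv)))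
      (sub_nonneg.2 hxy.le)
    ring_nf at h₁ h₂ h₃ ⊢
    linarith

theorem markovProduct_productPatch (C : Copula) {x y a b v : ℝ} (hx : 0 ≤ x) (hxy : x < y)
    (hy : y ≤ 1) (ha : 0 < a) (hb : 0 < b) (hab : a + b = 1) (hv : v ∈ Icc (0 : ℝ) 1) :
    (productPatch x y hx hxy hy).markovProduct C (a * x + b * y) v = a * C x v + b * C y v := by
  have h0 : (0 : ℝ) ∈ Icc (0 : ℝ) 1 := by simp
  have h1 : (1 : ℝ) ∈ Icc (0 : ℝ) 1 := by simp
  have hxI : x ∈ Icc (0 : ℝ) 1 := ⟨hx, by linarith⟩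
  have hyI : y ∈ Icc (0 : ℝ) 1 := ⟨by linarith, hy⟩
  obtain rfl : a = 1 - b := by linarith
  have hu : (1 - b) * x + b * y = x + b * (y - x) := by ring
  have hxu : x ≤ x + b * (y - x) := by nlinarith
  have huy : x + b * (y - x) ≤ y := by nlinarith
  rw [hu]
  have hne : y - x ≠ 0 := by linarith
  have hval : ∀ t, productPatch x y hx hxy hy (x + b * (y - x)) t
      = min x t + b * max 0 (min (t - x) (y - x)) := by
    intro t
    have h₁ : x + b * (y - x) - x = b * (y - x) := by ring
    simp only [productPatch]
    rw [h₁, min_eq_left (by linarith : b * (y - x) ≤ y - x),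
      max_eq_right (by nlinarith : 0 ≤ b * (y - x)),
      max_eq_left (by linarith [min_le_left (x + b * (y - x)) t] :
        min (x + b * (y - x)) t - y ≤ 0), ← min_assoc, min_eq_left hxu]
    field_simp
    ring
  set D := productPatch x y hx hxy hy
  have hD : ∀ t, D.partial₂ (x + b * (y - x)) t
      = deriv (fun t => min x t + b * max 0 (min (t - x) (y - x))) t := fun t => by
    simp only [partial₂, hval]
  have d1 : ∀ t ∈ Ioo 0 x, D.partial₂ (x + b * (y - x)) t = 1 := by
    intro t ht
    rw [hD]
    refine (HasDerivAt.congr_of_eventuallyEq (hasDerivAt_id t) ?_).deriv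
    filter_upwards [Iio_mem_nhds ht.2] with s hs
    have hs : s < x := hs
    rw [min_eq_right hs.le, max_eq_left ((min_le_left _ _).trans (by linarith))]
    simp
  have d2 : ∀ t ∈ Ioo x y, D.partial₂ (x + b * (y - x)) t = b := by
    intro t ht
    rw [hD]
    have hd : HasDerivAt (fun s : ℝ => x + b * (s - x)) b t := by
      simpa using (((hasDerivAt_id t).sub_const x).const_mul b).const_add x
    refine (hd.congr_of_eventuallyEq ?_).deriv
    filter_upwards [Ioo_mem_nhds ht.1 ht.2] with s hs
    rw [min_eq_left hs.1.le, min_eq_left (by linarith [hs.2]), max_eq_right (by linarith [hs.1])]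
  have d3 : ∀ t ∈ Ioo y 1, D.partial₂ (x + b * (y - x)) t = 0 := by
    intro t ht
    rw [hD]
    refine ((hasDerivAt_const t (x + b * (y - x))).congr_of_eventuallyEq ?_).deriv
    filter_upwards [Ioi_mem_nhds ht.1] with s hs
    have hs : y < s := hs
    rw [min_eq_left (by linarith), min_eq_right (by linarith), max_eq_right (by linarith)]
  have hF := fun {a b : ℝ} (ha : a ∈ Icc (0 : ℝ) 1) (hb : b ∈ Icc (0 : ℝ) 1) =>
    (C.lipschitzOnWith_left hv).intervalIntegrable_deriv_and_integral_deriv ha hb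
  -- Open intervals suffice: the kinks at `x` and `y` are null.
  have piece : ∀ {p q k : ℝ}, p ∈ Icc (0 : ℝ) 1 → q ∈ Icc (0 : ℝ) 1 → p ≤ q →
      (∀ t ∈ Ioo p q, D.partial₂ (x + b * (y - x)) t = k) →
      IntervalIntegrable (fun t => D.partial₂ (x + b * (y - x)) t * C.partial₁ t v) volume p q ∧
      ∫ t in p..q, D.partial₂ (x + b * (y - x)) t * C.partial₁ t v = k * (C q v - C p v) := by
    intro p q k hp hq hpq hk
    have hE : EqOn (fun t => k * C.partial₁ t v)
        (fun t => D.partial₂ (x + b * (y - x)) t * C.partial₁ t v) (Ioo p q) :=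
      fun t ht => by simp only [hk t ht]
    constructor
    · have hi : IntervalIntegrable (fun t => k * C.partial₁ t v) volume p q :=
        (hF hp hq).1.const_mul k
      rw [intervalIntegrable_iff_integrableOn_Ioo_of_le hpq] at hi ⊢
      exact hi.congr_fun hE measurableSet_Ioo
    · rw [← (hF hp hq).2, ← intervalIntegral.integral_const_mul,
        intervalIntegral.integral_of_le hpq, intervalIntegral.integral_of_le hpq,
        integral_Ioc_eq_integral_Ioo, integral_Ioc_eq_integral_Ioo]
      exact (setIntegral_congr_fun measurableSet_Ioo hE).symm
  obtain ⟨i1, e1⟩ := piece h0 hxI hx d1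
  obtain ⟨i2, e2⟩ := piece hxI hyI hxy.le d2
  obtain ⟨i3, e3⟩ := piece hyI h1 hy d3
  rw [markovProduct, ← intervalIntegral.integral_add_adjacent_intervals (i1.trans i2) i3,
    ← intervalIntegral.integral_add_adjacent_intervals i1 i2, e1, e2, e3, C.zero_left v hv]
  ring

theorem integral_partial₂ (D : Copula) {u : ℝ} (hu : u ∈ Icc (0 : ℝ) 1) :
    ∫ t in (0 : ℝ)..1, D.partial₂ u t = u := by
  have h := ((D.lipschitzOnWith_right hu).intervalIntegrable_deriv_and_integral_deriv
    (a := 0) (b := 1) (by simp) (by simp)).2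
  rwa [D.one_right u hu, D.zero_right u hu, sub_zero] at h

theorem integral_partial₁ (C : Copula) {u v : ℝ} (hu : u ∈ Icc (0 : ℝ) 1)
    (hv : v ∈ Icc (0 : ℝ) 1) : ∫ t in (0 : ℝ)..u, C.partial₁ t v = C u v := by
  have h := ((C.lipschitzOnWith_left hv).intervalIntegrable_deriv_and_integral_deriv
    (a := 0) (by simp) hu).2
  rwa [C.zero_left v hv, sub_zero] at h

theorem StochIncreasing₁.markovProduct_le {C : Copula} (hC : C.StochIncreasing₁) (D : Copula)
    {u v : ℝ} (hu : u ∈ Icc (0 : ℝ) 1) (hv : v ∈ Icc (0 : ℝ) 1) :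
    D.markovProduct C u v ≤ C u v := by
  obtain ⟨N, hN, -, hanti⟩ := hC v hv
  rw [← C.integral_partial₁ hu hv]
  exact integral_mul_le_integral_of_antitoneOn (measurable_deriv _) (measurable_deriv _)
    (fun t => deriv_mem_Icc_of_monotoneOn_of_lipschitzOnWith (C.monotoneOn_left hv)
      (C.lipschitzOnWith_left hv))
    (fun t => deriv_mem_Icc_of_monotoneOn_of_lipschitzOnWith (D.monotoneOn_right hu)
      (D.lipschitzOnWith_right hu)) hu (D.integral_partial₂ hu) hN hanti

theorem StochDecreasing₁.le_markovProduct {C : Copula} (hC : C.StochDecreasing₁) (D : Copula)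
    {u v : ℝ} (hu : u ∈ Icc (0 : ℝ) 1) (hv : v ∈ Icc (0 : ℝ) 1) :
    C u v ≤ D.markovProduct C u v := by
  obtain ⟨N, hN, -, hmono⟩ := hC v hv
  rw [← C.integral_partial₁ hu hv]
  exact integral_le_integral_mul_of_monotoneOn (measurable_deriv _) (measurable_deriv _)
    (fun t => deriv_mem_Icc_of_monotoneOn_of_lipschitzOnWith (C.monotoneOn_left hv)
      (C.lipschitzOnWith_left hv))
    (fun t => deriv_mem_Icc_of_monotoneOn_of_lipschitzOnWith (D.monotoneOn_right hu)
      (D.lipschitzOnWith_right hu)) hu (D.integral_partial₂ hu) hN hmono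

/-- The chord slope over `[a,b]` separates the derivatives at `a` and `b`. -/
theorem stochIncreasing₁_of_concaveOn {C : Copula}
    (h : ∀ v ∈ Icc (0 : ℝ) 1, ConcaveOn ℝ (Icc 0 1) fun s => C s v) : C.StochIncreasing₁ := by
  intro v hv
  obtain ⟨N, hN, hd⟩ := (C.lipschitzOnWith_left hv).exists_null_differentiableAt
  refine ⟨N, hN, fun u hu => (hd u hu).2, fun a ha b hb hab => ?_⟩
  rcases hab.eq_or_lt with rfl | hab
  · rfl
  · exact ((h v hv).deriv_le_slope ha.1 hb.1 hab (hd b hb).2).trans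
      ((h v hv).slope_le_deriv ha.1 hb.1 hab (hd a ha).2)

theorem stochDecreasing₁_of_convexOn {C : Copula}
    (h : ∀ v ∈ Icc (0 : ℝ) 1, ConvexOn ℝ (Icc 0 1) fun s => C s v) : C.StochDecreasing₁ := by
  intro v hv
  obtain ⟨N, hN, hd⟩ := (C.lipschitzOnWith_left hv).exists_null_differentiableAt
  refine ⟨N, hN, fun u hu => (hd u hu).2, fun a ha b hb hab => ?_⟩
  rcases hab.eq_or_lt with rfl | hab
  · rfl
  · exact ((h v hv).deriv_le_slope ha.1 hb.1 hab (hd a ha).2).trans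
      ((h v hv).slope_le_deriv ha.1 hb.1 hab (hd b hb).2)

end Copula

theorem mainTheorem2 (C : Copula) :
    (C.StochIncreasing₁ ↔
      ∀ D : Copula, ∀ u ∈ Set.Icc (0 : ℝ) 1, ∀ v ∈ Set.Icc (0 : ℝ) 1,
        Copula.markovProduct D C u v ≤ C u v) ∧
    (C.StochDecreasing₁ ↔
      ∀ D : Copula, ∀ u ∈ Set.Icc (0 : ℝ) 1, ∀ v ∈ Set.Icc (0 : ℝ) 1,
        C u v ≤ Copula.markovProduct D C u v) := by
  refine ⟨⟨fun hC D u hu v hv => hC.markovProduct_le D hu hv, fun h => ?_⟩,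
    ⟨fun hC D u hu v hv => hC.le_markovProduct D hu hv, fun h => ?_⟩⟩
  · refine Copula.stochIncreasing₁_of_concaveOn fun v hv => ?_
    -- Reduces to `x < y`, so that the patch is nondegenerate.
    refine LinearOrder.concaveOn_of_lt (convex_Icc 0 1) fun x hx y hy hxy a b ha hb hab => ?_
    have := h (Copula.productPatch x y hx.1 hxy hy.2) (a * x + b * y)
      (convex_Icc 0 1 hx hy ha.le hb.le hab) v hv
    rwa [C.markovProduct_productPatch hx.1 hxy hy.2 ha hb hab hv] at this
  · refine Copula.stochDecreasing₁_of_convexOn fun v hv => ?_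
    refine LinearOrder.convexOn_of_lt (convex_Icc 0 1) fun x hx y hy hxy a b ha hb hab => ?_
    have := h (Copula.productPatch x y hx.1 hxy hy.2) (a * x + b * y)
      (convex_Icc 0 1 hx hy ha.le hb.le hab) v hv
    rwa [C.markovProduct_productPatch hx.1 hxy hy.2 ha hb hab hv] at this
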